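/- Let $H$ be a complex Hilbert space and $B(H)$ the algebra of bounded linear operators on $H$. An operator algebra on $H$ is a norm-closed (not necessarily unital) complex subalgebra $A\subseteq B(H)$. A Hilbertian $A$-module is a complex Banach space $X$ that is isomorphic (by a bicontinuous linear bijection) to a Hilbert space, together with a norm-continuous algebra homomorphism $\theta: A\to B(X)$ (not required to preserve a unit of $A$, if there is one). The algebra $A$ has the total reduction property if for every Hilbertian $A$-module $(X,\theta)$ and every closed $\theta(A)$-invariant subspace $V\subseteq X$ there is a closed $\theta(A)$-invariant subspace $W\subseteq X$ with $X=V\oplus W$. Proposition. Let $A\subseteq B(H)$ be an abelian operator algebra with the total reduction property, and suppose that $A$ is contained in some abelian C*-subalgebra of $B(H)$. Then $A$ is self-adjoint, i.e. $a^*\in A$ for every $a\in A$. -/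

import Mathlib

universe u v

/-- A subalgebra of a normed algebra is a normed space with the restricted norm. -/
instance NonUnitalSubalgebra.instNormedSpaceComplex {E : Type v} [NonUnitalNormedRing E]
    [NormedSpace ℂ E] (A : NonUnitalSubalgebra ℂ E) : NormedSpace ℂ A where
  norm_smul_le c a := norm_smul_le c (a : E)

/-- A complex normed space is Hilbertian if it is isomorphic, by a bicontinuous linear bijection,
to a complex Hilbert space. (Such a space is automatically complete.) -/
def IsHilbertian (X : Type u) [NormedAddCommGroup X] [NormedSpace ℂ X] : Prop :=
  ∃ (K : Type u) (_ : NormedAddCommGroup K) (_ : InnerProductSpace ℂ K) (_ : CompleteSpace K),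
    Nonempty (X ≃L[ℂ] K)

/-- The reduction property of the Banach module `X` over `A` given by `θ : A → B(X)`:
every closed submodule `V` of `X` has a complementary closed submodule `W`, `X = V ⊕ W`.
Representations need not preserve a unit, even if `A` has one. -/
def HasReductionProperty {A : Type v} [NonUnitalNormedRing A] [NormedSpace ℂ A]
    {X : Type u} [NormedAddCommGroup X] [NormedSpace ℂ X] (θ : A →ₙₐ[ℂ] (X →L[ℂ] X)) : Prop :=
  ∀ V : Submodule ℂ X, IsClosed (V : Set X) → (∀ a : A, ∀ x ∈ V, θ a x ∈ V) →
    ∃ W : Submodule ℂ X, IsClosed (W : Set X) ∧ (∀ a : A, ∀ x ∈ W, θ a x ∈ W) ∧ IsCompl V W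

/-- The total reduction property of `A`: every Hilbertian `A`-module, that is, every
norm-continuous representation of `A` on a Hilbertian space, has the reduction property. -/
def HasTotalReductionProperty (A : Type u) [NonUnitalNormedRing A] [NormedSpace ℂ A] : Prop :=
  ∀ (X : Type u) [NormedAddCommGroup X] [NormedSpace ℂ X], IsHilbertian X →
    ∀ θ : A →ₙₐ[ℂ] (X →L[ℂ] X), Continuous θ → HasReductionProperty θ

/-!
Suppose `a ∈ A` but `star a ∉ A`. The elements of `A` are normal operators, because `A` lies in a
commutative C⋆-algebra.

The first ingredient is a Hahn–Banach argument (`Submodule.exists_positiveLinearMap_le_re`): since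
`b ↦ star (star a - b) * (star a - b)` is convex for the order of `B(H)` and its values have norm
at least the squared distance `d ^ 2` from `star a` to `A`, the open ball of radius `d ^ 2` can be
separated from the upper set generated by these values. The separating functional is positive on
`B(H)` and bounded below by a positive constant on all of these values. In the corresponding GNS
representation `π` with `ξ` the class of `1`, this means that `π (star a) ξ` is not in the closure
`V` of `π(A) ξ`.

The second ingredient (`HasReductionProperty.star_apply_mem_closure_range`) contradicts this. The
total reduction property provides a closed `A`-invariant complement `W` of `V`; the bounded
projection onto `V` along `W` commutes with the normal operators `π b`, hence, by Fuglede's theorem,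
with their adjoints. Write `ξ = v + w` with `v ∈ V` and `w ∈ W`. Then `π a w = π a ξ - π a v` lies in
`V ∩ W = 0`, so that `π (star a) w = 0` by normality, and `π (star a) ξ = π (star a) v ∈ V`.
-/

open scoped ComplexOrder ComplexStarModule

/-- If the reduction property holds for an action by normal operators on a Hilbert space, then the
closed cyclic submodule generated by a vector also contains the images of that vector under the
adjoints. The action may be degenerate, so that `ξ` itself need not lie in this submodule. -/
theorem HasReductionProperty.star_apply_mem_closure_range {A : Type*} [NonUnitalNormedRing A]
    [NormedSpace ℂ A] {K : Type*} [NormedAddCommGroup K] [InnerProductSpace ℂ K] [CompleteSpace K]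
    {θ : A →ₙₐ[ℂ] (K →L[ℂ] K)} (hθ : HasReductionProperty θ) (hn : ∀ a, IsStarNormal (θ a))
    (ξ : K) (a : A) : star (θ a) ξ ∈ closure (Set.range fun b => θ b ξ) := by
  let L : A →ₗ[ℂ] K := (ContinuousLinearMap.apply ℂ K ξ).toLinearMap ∘ₗ (θ : A →ₗ[ℂ] (K →L[ℂ] K))
  set V : Submodule ℂ K := L.range.topologicalClosure
  have hVmem (x : K) : x ∈ V ↔ x ∈ closure (Set.range fun b => θ b ξ) := Iff.rfl
  have hVinv : ∀ b : A, ∀ x ∈ V, θ b x ∈ V := by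
    intro b x hx
    rw [hVmem] at hx ⊢
    refine map_mem_closure (θ b).continuous hx ?_
    rintro _ ⟨c, rfl⟩
    exact ⟨b * c, by simp⟩
  obtain ⟨W, hWc, hWinv, hVW⟩ := hθ V L.range.isClosed_topologicalClosure hVinv
  have hT : Submodule.IsTopCompl V W :=
    Submodule.IsCompl.isTopCompl_of_isClosed hVW L.range.isClosed_topologicalClosure hWc
  set P : K →L[ℂ] K := V.projectionL W hT
  have hPV (x : K) (hx : x ∈ V) : P x = x := Submodule.projectionL_apply_left hT ⟨x, hx⟩
  have hPW (x : K) (hx : x ∈ W) : P x = 0 := (Submodule.projectionL_apply_eq_zero_iff hT).2 hx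
  have hPmem (x : K) : P x ∈ V := Submodule.projectionL_apply_mem hT x
  obtain ⟨v, hv, w, hw, hvw⟩ := Submodule.mem_sup.1 (hVW.sup_eq_top ▸ Submodule.mem_top (x := ξ))
  have hcomm : Commute P (θ a) := by
    ext x
    obtain ⟨y, hy, z, hz, rfl⟩ :=
      Submodule.mem_sup.1 (hVW.sup_eq_top ▸ Submodule.mem_top (x := x))
    simp [hPV y hy, hPW z hz, hPV _ (hVinv a y hy), hPW _ (hWinv a z hz)]
  have hw0 : θ a w = 0 := by
    refine (Submodule.disjoint_def.1 hVW.disjoint) _ ?_ (hWinv a w hw)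
    have : θ a w = θ a ξ - θ a v := by rw [← hvw, map_add, add_sub_cancel_left]
    rw [this]
    exact V.sub_mem ((hVmem _).2 (subset_closure ⟨a, rfl⟩)) (hVinv a v hv)
  have hw1 : star (θ a) w = 0 :=
    (ContinuousLinearMap.IsStarNormal.adjoint_apply_eq_zero_iff (hn a) w).2 hw0
  have hfug : P (star (θ a) v) = star (θ a) (P v) :=
    congr($(((hn a).commute_star_right hcomm).eq) v)
  rw [← hVmem, ← hvw, map_add, hw1, add_zero, ← hPV v hv, ← hfug]
  exact hPmem _

/-- The map `x ↦ star x * x` is convex for the order of a C⋆-algebra: the difference of the two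
sides is `(r * s) • (star (x - y) * (x - y))`. -/
theorem star_smul_add_smul_mul_self_le {E : Type*} [CStarAlgebra E] [PartialOrder E]
    [StarOrderedRing E] (x y : E) {r s : ℝ} (hr : 0 ≤ r) (hs : 0 ≤ s) (hrs : r + s = 1) :
    star (r • x + s • y) * (r • x + s • y) ≤ r • (star x * x) + s • (star y * y) := by
  rw [← sub_nonneg]
  have : r • (star x * x) + s • (star y * y) - star (r • x + s • y) * (r • x + s • y)
      = (r * s) • (star (x - y) * (x - y)) := by
    obtain rfl : s = 1 - r := by linarith
    simp only [star_add, star_sub, star_smul, star_trivial, add_mul, mul_add, sub_mul, mul_sub,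
      smul_mul_assoc, mul_smul_comm]
    module
  rw [this]
  exact smul_nonneg (mul_nonneg hr hs) (star_mul_self_nonneg _)

/-- A point outside a closed subspace of a C⋆-algebra can be kept away from it in the seminorm
`x ↦ (ρ (star x * x)) ^ (1 / 2)` of a single positive functional `ρ`. -/
theorem Submodule.exists_positiveLinearMap_le_re {E : Type*} [CStarAlgebra E] [PartialOrder E]
    [StarOrderedRing E] (S : Submodule ℂ E) (hS : IsClosed (S : Set E)) {t : E} (ht : t ∉ S) :
    ∃ (ρ : E →ₚ[ℂ] ℂ) (u : ℝ), 0 < u ∧ ∀ b ∈ S, u ≤ (ρ (star (t - b) * (t - b))).re := by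
  obtain ⟨d, hd, hdS⟩ : ∃ d > 0, ∀ b ∈ S, d ≤ ‖t - b‖ := by
    obtain ⟨d, hd, hball⟩ := Metric.isOpen_iff.1 hS.isOpen_compl t ht
    refine ⟨d, hd, fun b hb => not_lt.1 fun hlt => hball (a := b) ?_ hb⟩
    rwa [Metric.mem_ball, dist_comm, dist_eq_norm]
  -- Only the real part is constrained, which forces the functional to be real on positive elements.
  let C : Set E := {h | ∃ b ∈ S, star (t - b) * (t - b) ≤ (ℜ h : E)}
  have hC : Convex ℝ C := by
    rintro h ⟨b, hb, hbh⟩ k ⟨c, hc, hck⟩ r s hr hs hrs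
    refine ⟨r • b + s • c, S.add_mem (S.smul_of_tower_mem r hb) (S.smul_of_tower_mem s hc), ?_⟩
    have htbc : t - (r • b + s • c) = r • (t - b) + s • (t - c) := by
      obtain rfl : s = 1 - r := by linarith
      module
    rw [htbc]
    refine (star_smul_add_smul_mul_self_le _ _ hr hs hrs).trans ?_
    rw [map_add, map_smul, map_smul]
    exact add_le_add (smul_le_smul_of_nonneg_left hbh hr) (smul_le_smul_of_nonneg_left hck hs)
  have hdisj : Disjoint (Metric.ball (0 : E) (d ^ 2)) C := by
    refine Set.disjoint_left.2 ?_
    rintro h hh ⟨b, hb, hbh⟩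
    have h1 := CStarAlgebra.norm_le_norm_of_nonneg_of_le (star_mul_self_nonneg (t - b)) hbh
    rw [CStarRing.norm_star_mul_self] at h1
    have h2 : ‖(ℜ h : E)‖ ≤ ‖h‖ := realPart.norm_le h
    have h3 : ‖h‖ < d ^ 2 := by simpa using hh
    nlinarith [hdS b hb]
  obtain ⟨f, u, hfball, hfC⟩ :=
    RCLike.geometric_hahn_banach_open (𝕜 := ℂ) (convex_ball (0 : E) (d ^ 2)) Metric.isOpen_ball hC
      hdisj
  have hu : 0 < u := by simpa using hfball 0 (Metric.mem_ball_self (by positivity))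
  -- `C` is stable under adding nonnegative multiples of such `k`, and `re f` is bounded below on `C`.
  have hre (k : E) (hk : 0 ≤ (ℜ k : E)) : 0 ≤ (f k).re := by
    by_contra! hneg
    obtain ⟨n, hn⟩ := exists_nat_gt ((f (star t * t)).re / -(f k).re)
    rw [div_lt_iff₀ (by linarith)] at hn
    have hmem : star t * t + (n : ℝ) • k ∈ C := by
      refine ⟨0, S.zero_mem, ?_⟩
      rw [map_add, map_smul]
      simp only [sub_zero, AddSubgroup.coe_add, selfAdjoint.val_smul,
        (IsSelfAdjoint.star_mul_self t).coe_realPart]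
      exact le_add_of_nonneg_right (smul_nonneg (by positivity) hk)
    have := hfC _ hmem
    rw [map_add, ← Complex.coe_smul, map_smul] at this
    simp at this
    linarith
  have hpos (p : E) (hp : 0 ≤ p) : 0 ≤ f p := by
    have hsa : IsSelfAdjoint p := .of_nonneg hp
    have h1 := hre p (by rwa [hsa.coe_realPart])
    have h2 := hre (Complex.I • p) (by simp [realPart_I_smul, hsa.imaginaryPart])
    have h3 := hre (-(Complex.I • p)) (by simp [realPart_I_smul, hsa.imaginaryPart])
    simp at h2 h3
    exact Complex.nonneg_iff.2 ⟨h1, by linarith⟩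
  refine ⟨PositiveLinearMap.mk₀ f.toLinearMap hpos, u, hu, fun b hb => hfC _ ⟨b, hb, ?_⟩⟩
  rw [(IsSelfAdjoint.star_mul_self (t - b)).coe_realPart]

theorem mainTheorem7 {H : Type u} [NormedAddCommGroup H] [InnerProductSpace ℂ H] [CompleteSpace H]
    (A : NonUnitalSubalgebra ℂ (H →L[ℂ] H))
    (hA_closed : IsClosed (A : Set (H →L[ℂ] H)))
    (hA_comm : ∀ a ∈ A, ∀ b ∈ A, a * b = b * a)
    (hA_trp : HasTotalReductionProperty A)
    (hAB : ∃ B : NonUnitalStarSubalgebra ℂ (H →L[ℂ] H),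
      IsClosed (B : Set (H →L[ℂ] H)) ∧ (∀ a ∈ B, ∀ b ∈ B, a * b = b * a) ∧
        (A : Set (H →L[ℂ] H)) ⊆ B) :
    ∀ a ∈ A, star a ∈ A := by
  intro a ha
  obtain ⟨B, -, hB, hAB⟩ := hAB
  by_contra hstar
  obtain ⟨ρ, u, hu, hρ⟩ := A.toSubmodule.exists_positiveLinearMap_le_re hA_closed hstar
  let π := ρ.gnsNonUnitalStarAlgHom
  let θ : A →ₙₐ[ℂ] (ρ.GNS →L[ℂ] ρ.GNS) :=
    (π : (H →L[ℂ] H) →ₙₐ[ℂ] (ρ.GNS →L[ℂ] ρ.GNS)).comp (NonUnitalSubalgebraClass.subtype A)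
  have hθ (b : A) : θ b = π b := rfl
  have hπ : Continuous π :=
    AddMonoidHomClass.continuous_of_bound π 1 fun x => by
      simpa using NonUnitalStarAlgHom.norm_apply_le π x
  have hn (b : A) : IsStarNormal (θ b) := by
    refine ⟨?_⟩
    rw [hθ, ← map_star, Commute, SemiconjBy, ← map_mul, ← map_mul,
      hB _ (star_mem (hAB b.2)) _ (hAB b.2)]
  have hred : HasReductionProperty θ :=
    hA_trp ρ.GNS ⟨ρ.GNS, inferInstance, inferInstance, inferInstance, ⟨.refl ℂ _⟩⟩ θ
      (hπ.comp continuous_subtype_val)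
  have hmem := hred.star_apply_mem_closure_range hn (ρ.toPreGNS 1 : ρ.GNS) ⟨a, ha⟩
  obtain ⟨_, ⟨b, rfl⟩, hb⟩ := Metric.mem_closure_iff.1 hmem (√u) (Real.sqrt_pos.2 hu)
  have hdiff : star (θ ⟨a, ha⟩) (ρ.toPreGNS 1 : ρ.GNS) - θ b (ρ.toPreGNS 1 : ρ.GNS)
      = (ρ.toPreGNS (star a - b) : ρ.GNS) := by
    rw [hθ, hθ, ← map_star, ← sub_apply, ← map_sub]
    simp [π, UniformSpace.Completion.coe_sub]
  rw [dist_eq_norm, hdiff, UniformSpace.Completion.norm_coe, PositiveLinearMap.preGNS_norm_def]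
    at hb
  exact (Real.sqrt_le_sqrt (hρ b b.2)).not_gt hb
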